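/- **Setting.** Let $\mathcal{X}\subseteq\mathbb{R}^d$ be measurable, let $D$ be a probability distribution on $\mathcal{X}\times\{0,1\}$ with marginal $\mu$ on $\mathcal{X}$, and let $\eta:\mathcal{X}\to[0,1]$ be a (measurable) version of $\eta(x)=\Pr(y=1\mid x)$. Let $S_n$ be an i.i.d. sample of size $n$ from $D$. For $k\ge 1$, $A_k(S_n,x)$ is the $k$-nearest neighbor classifier for the Euclidean distance: it outputs $1$ if the labels $Y^{(1)}(x),\dots,Y^{(k)}(x)$ of the $k$ sample points nearest to $x$ (ties broken arbitrarily) satisfy $Y^{(1)}(x)+\dots+Y^{(k)}(x)\ge k/2$, and $0$ otherwise. Write $B^o(x,r)$ and $B(x,r)$ for the open and closed balls in $\mathcal{X}$, and (with $\inf\emptyset=\infty$) $$r_p(x)=\inf\{t\mid \mu(B(x,t))\ge p\},\qquad \rho(f,x)=\inf\{t\mid \exists x'\in B(x,t),\ f(x')\ne f(x)\}.$$ The astuteness of $f$ at radius $r$ is $\mathrm{Ast}_D(f,r)=\Pr_{(x,y)\sim D}(\rho(f,x)\ge r,\ f(x)=y)$. The $r$-robust $(p,\Delta)$-interiors are $$\hat{\mathcal{X}}^+_{r,\Delta,p}=\{x\in\mathcal{X}\cap\mathrm{supp}(\mu)\mid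 \forall x'\in B^o(x,r),\ \forall x''\in B(x',r_p(x')),\ \eta(x'')\ge \tfrac12+\Delta\},$$ $$\hat{\mathcal{X}}^-_{r,\Delta,p}=\{x\in\mathcal{X}\cap\mathrm{supp}(\mu)\mid \forall x'\in B^o(x,r),\ \forall x''\in B(x',r_p(x')),\ \eta(x'')\le \tfrac12-\Delta\}.$$ **Theorem.** Assume that $\mu$ is absolutely continuous with respect to Lebesgue measure. Fix $k\ge 1$, $p>0$ and $\delta>0$. Then there is an $n_0$ such that for all $n\ge n_0$ and all $r>0$: 1. with probability at least $1-\delta$ over $S_n$, $\rho(A_k(S_n,\cdot),x)\ge r$ simultaneously for all $x\in\hat{\mathcal{X}}^+_{r,1/2,p}\cup\hat{\mathcal{X}}^-_{r,1/2,p}$ (on these sets $\eta(x)\in\{0,1\}$); 2. with probability at least $1-\delta$ over $S_n$, the astuteness of the $k$-NN classifier at radius $r$ satisfies $$\mathrm{Ast}_D(A_k(S_n,\cdot),r)\ \ge\ \mu\big(\hat{\mathcal{X}}^+_{r,1/2,p}\cup\hat{\mathcal{X}}^-_{r,1/2,p}\big).$$ -/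

import Mathlib

open MeasureTheory
open scoped ENNReal

noncomputable section

namespace RobustKNN

/-- `ℝ^d` with its Euclidean norm. -/
abbrev E (d : ℕ) : Type := EuclideanSpace ℝ (Fin d)

/-- `η` is a version of the conditional probability `x ↦ Pr(y = 1 | x)` under the data
distribution `D` of labelled examples `(x, y)`, `y ∈ {0, 1}`.  The marginal of `D` on the
instances is `D.fst`. -/
structure IsCondLabelProb {d : ℕ} (D : Measure (E d × Fin 2)) (η : E d → ℝ) : Prop where
  measurable : Measurable η
  mem_Icc : ∀ x, η x ∈ Set.Icc (0 : ℝ) 1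
  setLIntegral_eq : ∀ A : Set (E d), MeasurableSet A →
    D (A ×ˢ {(1 : Fin 2)}) = ∫⁻ x in A, ENNReal.ofReal (η x) ∂D.fst

/-- `f` is a `k`-nearest neighbour classifier for the training sample `S`: at each `x` there is
a set `I` of `k` sample points that are nearest to `x` (ties in distance broken in any way), and
`f x = 1` if the sum of their labels is at least `k / 2`, and `f x = 0` otherwise. -/
def IsKNNClassifier {d n : ℕ} (k : ℕ) (S : Fin n → E d × Fin 2) (f : E d → Fin 2) : Prop :=
  ∀ x : E d, ∃ I : Finset (Fin n), I.card = k ∧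
    (∀ i ∈ I, ∀ j ∉ I, dist x (S i).1 ≤ dist x (S j).1) ∧
    f x = if (k : ℝ) / 2 ≤ ∑ i ∈ I, (((S i).2 : ℕ) : ℝ) then 1 else 0

/-- The robustness radius of `f` at `x` over the instance space `𝒳`: the infimum of the radii of
closed balls around `x` containing an instance that `f` labels differently from `x`
(`∞` if there is no such instance). -/
def robustnessRadius {d : ℕ} (𝒳 : Set (E d)) (f : E d → Fin 2) (x : E d) : ℝ≥0∞ :=
  sInf {t : ℝ≥0∞ | ∃ x' ∈ 𝒳 ∩ Metric.closedEBall x t, f x ≠ f x'}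

/-- The astuteness of `f` at radius `r`: the probability under `D` that `f` is correct and has
robustness radius at least `r`. -/
def astuteness {d : ℕ} (𝒳 : Set (E d)) (D : Measure (E d × Fin 2)) (f : E d → Fin 2) (r : ℝ) :
    ℝ≥0∞ :=
  D {z | ENNReal.ofReal r ≤ robustnessRadius 𝒳 f z.1 ∧ f z.1 = z.2}

/-- The probability radius `r_p(x) = inf {t | μ(B(x, t)) ≥ p}` (`∞` if there is no such
finite `t`), with `B` the closed ball. -/
def probRadius {d : ℕ} (μ : Measure (E d)) (p : ℝ) (x : E d) : ℝ≥0∞ :=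
  sInf {t : ℝ≥0∞ | ENNReal.ofReal p ≤ μ (Metric.closedEBall x t)}

/-- The `r`-robust `(p, Δ)`-interior of the positive class; balls are balls of the instance
space `𝒳`. -/
def interiorPos {d : ℕ} (𝒳 : Set (E d)) (μ : Measure (E d)) (η : E d → ℝ) (r Δ p : ℝ) :
    Set (E d) :=
  {x | x ∈ 𝒳 ∩ μ.support ∧ ∀ x' ∈ 𝒳 ∩ Metric.ball x r,
    ∀ x'' ∈ 𝒳 ∩ Metric.closedEBall x' (probRadius μ p x'), 1 / 2 + Δ ≤ η x''}

/-- The `r`-robust `(p, Δ)`-interior of the negative class. -/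
def interiorNeg {d : ℕ} (𝒳 : Set (E d)) (μ : Measure (E d)) (η : E d → ℝ) (r Δ p : ℝ) :
    Set (E d) :=
  {x | x ∈ 𝒳 ∩ μ.support ∧ ∀ x' ∈ 𝒳 ∩ Metric.ball x r,
    ∀ x'' ∈ 𝒳 ∩ Metric.closedEBall x' (probRadius μ p x'), η x'' ≤ 1 / 2 - Δ}

/-- The event `A` has probability at least `q`.  For an event not known to be measurable this
asks for a measurable event inside `A` of probability at least `q`; for measurable `A` it is
just `q ≤ P A`. -/
def WithProbAtLeast {Ω : Type*} [MeasurableSpace Ω] (P : Measure Ω) (q : ℝ) (A : Set Ω) : Prop :=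
  ∃ G ⊆ A, MeasurableSet G ∧ ENNReal.ofReal q ≤ P G

end RobustKNN

end

/-! On a ball `B(x', r_p(x'))` where `η` is constantly `1` (or `0`), almost surely all sample labels
agree, so `k`-NN is correct at `x'` once that ball holds `k` sample points. It therefore suffices
that, with high probability, all closed balls of mass at least `min p 1` hold `k` sample points
simultaneously.

This uniformity comes from compactness. Balls are sublevel sets of quadratic functions whose
coefficients can be normalised to the unit sphere, and absolute continuity makes the zero sets of
these functions null. Hence `exists_finite_family_subset_closedEBall` gives finitely many sets of
positive mass, one inside each heavy ball. A union bound over this family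
(`exists_forall_withProbAtLeast`) yields an event and an `n₀` independent of `r` and of the
tie-breaking. On this event both claims are deterministic; `measure_union_le_astuteness` derives the
second from robustness and correctness. -/

namespace RobustKNN

open Filter Topology

/-! ### Balls as sublevel sets of quadratic functions -/

section Quadric

variable {V : Type*} [NormedAddCommGroup V] [InnerProductSpace ℝ V]

/-- The quadratic function `x ↦ a ‖x‖² + ⟪b, x⟫ + c` with coefficients `θ = (a, b, c)`. -/
def quadric (θ : ℝ × V × ℝ) (x : V) : ℝ :=
  θ.1 * ‖x‖ ^ 2 + inner ℝ θ.2.1 x + θ.2.2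

lemma continuous_quadric (θ : ℝ × V × ℝ) : Continuous (quadric θ) := by
  unfold quadric
  fun_prop

lemma continuous_quadric_left (x : V) : Continuous fun θ : ℝ × V × ℝ => quadric θ x := by
  unfold quadric
  fun_prop

lemma quadric_smul (s : ℝ) (θ : ℝ × V × ℝ) (x : V) : quadric (s • θ) x = s * quadric θ x := by
  simp only [quadric, Prod.smul_fst, Prod.smul_snd, smul_eq_mul, inner_smul_left]
  simp
  ring

lemma quadric_ball (y x : V) (s : ℝ) :
    quadric (1, (-2 : ℝ) • y, ‖y‖ ^ 2 - s ^ 2) x = dist x y ^ 2 - s ^ 2 := by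
  simp only [quadric, inner_smul_left, dist_eq_norm, norm_sub_sq_real, real_inner_comm x y]
  simp
  ring

/-- Every closed ball, of finite or infinite radius, is a sublevel set of a quadratic function
with normalised coefficients. -/
lemma exists_closedEBall_eq_quadric (y : V) (t : ℝ≥0∞) :
    ∃ θ ∈ Metric.sphere (0 : ℝ × V × ℝ) 1, Metric.closedEBall y t = {x | quadric θ x ≤ 0} := by
  -- Positive rescaling preserves the sublevel set, so any nonzero coefficients can be normalised.
  suffices h : ∃ θ : ℝ × V × ℝ, θ ≠ 0 ∧ Metric.closedEBall y t = {x | quadric θ x ≤ 0} by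
    obtain ⟨θ, h0, hθ⟩ := h
    have hn : 0 < ‖θ‖⁻¹ := inv_pos.2 (norm_pos_iff.2 h0)
    refine ⟨‖θ‖⁻¹ • θ, ?_, ?_⟩
    · rw [mem_sphere_zero_iff_norm, norm_smul, norm_inv, norm_norm,
        inv_mul_cancel₀ (norm_ne_zero_iff.2 h0)]
    · rw [hθ]
      ext x
      simp only [Set.mem_ofPred_eq, quadric_smul]
      constructor
      · exact fun h => mul_nonpos_of_nonneg_of_nonpos hn.le h
      · exact fun h => nonpos_of_mul_nonpos_right h hn
  rcases eq_or_ne t ∞ with rfl | ht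
  · refine ⟨(0, 0, -1), by simp, ?_⟩
    ext x
    simp [quadric]
  · refine ⟨(1, (-2 : ℝ) • y, ‖y‖ ^ 2 - t.toReal ^ 2), by simp, ?_⟩
    ext x
    rw [Set.mem_ofPred_eq, quadric_ball, sub_nonpos,
      sq_le_sq₀ dist_nonneg ENNReal.toReal_nonneg, Metric.mem_closedEBall, edist_dist,
      ENNReal.ofReal_le_iff_le_toReal ht]

/-- The zero set of a nonzero function `a ‖x‖² + ⟪b, x⟫ + c` is Lebesgue-null. -/
lemma volume_quadric_eq_zero [FiniteDimensional ℝ V] [MeasurableSpace V] [BorelSpace V]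
    [Nontrivial V] {θ : ℝ × V × ℝ} (hθ : θ ≠ 0) : volume {x | quadric θ x = 0} = 0 := by
  obtain ⟨a, b, c⟩ := θ
  by_cases ha : a = 0
  · subst ha
    by_cases hb : b = 0
    · subst hb
      have hc : c ≠ 0 := by
        rintro rfl
        exact hθ rfl
      simp [quadric, hc]
    · let s : AffineSubspace ℝ V :=
        (AffineSubspace.mk' (-c : ℝ) (⊥ : Submodule ℝ ℝ)).comap (innerₗ V b).toAffineMap
      have hs : ∀ x, x ∈ s ↔ inner ℝ b x = -c := by
        intro x
        simp [s, AffineSubspace.mem_comap, AffineSubspace.mem_mk', add_eq_zero_iff_eq_neg]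
      have hne : s ≠ ⊤ := by
        intro h
        have h1 := (hs 0).1 (h ▸ AffineSubspace.mem_top ℝ V 0)
        have h2 := (hs b).1 (h ▸ AffineSubspace.mem_top ℝ V b)
        rw [inner_zero_right] at h1
        rw [← h1, inner_self_eq_zero] at h2
        exact hb h2
      refine measure_mono_null (fun x hx => ?_) (Measure.addHaar_affineSubspace volume s hne)
      have hx' : quadric (0, b, c) x = 0 := hx
      simp only [quadric] at hx'
      exact (hs x).2 (by linarith)
  -- Completing the square puts the zero set in a sphere centred at `y`. If the squared radius is
  -- negative there is no such `x`, so its sign needs no case split.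
  · let y : V := (-(2 * a)⁻¹) • b
    refine measure_mono_null (fun x hx => ?_)
      (Measure.addHaar_sphere volume y (Real.sqrt (‖y‖ ^ 2 - c / a)))
    have hx' : a * ‖x‖ ^ 2 + inner ℝ b x + c = 0 := hx
    have key : dist x y ^ 2 = ‖y‖ ^ 2 - c / a := by
      rw [dist_eq_norm, norm_sub_sq_real, real_inner_comm]
      simp only [y, inner_smul_left]
      simp
      field_simp
      linarith
    rw [Metric.mem_sphere, ← key, Real.sqrt_sq dist_nonneg]

end Quadric

/-! ### Compactness: finitely many sets inside all heavy sublevel sets -/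

section Family

variable {Θ Ω : Type*} [PseudoMetricSpace Θ] [TopologicalSpace Ω] [MeasurableSpace Ω]

/-- Sublevel sets of a family of functions have a closed inner approximation that is uniform
over a neighbourhood of the parameter. -/
lemma exists_nhds_subset_sublevel {μ : Measure Ω} {q : Θ → Ω → ℝ} (hq : ∀ θ, Continuous (q θ))
    (hq' : ∀ x, Continuous fun θ => q θ x) {θ : Θ} {c : ℝ≥0∞} (hc : c < μ {x | q θ x < 0}) :
    ∃ U ∈ 𝓝 θ, ∃ C, IsClosed C ∧ c < μ C ∧ ∀ θ' ∈ U, C ⊆ {x | q θ' x ≤ 0} := by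
  -- Each `G m` is closed as an intersection over `θ'`. By continuity in the parameter they increase
  -- to a set containing the strict sublevel set, so some `G m` has mass above `c`.
  let G : ℕ → Set Ω := fun m => {x | ∀ θ' ∈ Metric.ball θ (1 / ((m : ℝ) + 1)), q θ' x ≤ 0}
  have hG : Monotone G := fun m m' h x hx θ' hθ' =>
    hx θ' (Metric.ball_subset_ball (Nat.one_div_le_one_div h) hθ')
  have hU : {x | q θ x < 0} ⊆ ⋃ m, G m := by
    intro x hx
    have h1 : ∀ᶠ θ' in 𝓝 θ, q θ' x < 0 := (hq' x).continuousAt.eventually_lt_const hx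
    obtain ⟨ε, hε, h2⟩ := Metric.eventually_nhds_iff_ball.1 h1
    obtain ⟨m, hm⟩ := exists_nat_one_div_lt hε
    exact Set.mem_iUnion.2 ⟨m, fun θ' hθ' => (h2 θ' (Metric.ball_subset_ball hm.le hθ')).le⟩
  have h3 : c < ⨆ m, μ (G m) := by
    rw [← hG.measure_iUnion]
    exact hc.trans_le (measure_mono hU)
  obtain ⟨m, hm⟩ := lt_iSup_iff.1 h3
  refine ⟨Metric.ball θ (1 / ((m : ℝ) + 1)), Metric.ball_mem_nhds _ Nat.one_div_pos_of_nat,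
    G m, ?_, hm, fun θ' hθ' x hx => hx θ' hθ'⟩
  have : G m = ⋂ θ' ∈ Metric.ball θ (1 / ((m : ℝ) + 1)), {x | q θ' x ≤ 0} := by
    ext x
    simp [G]
  rw [this]
  exact isClosed_biInter fun θ' _ => isClosed_le (hq θ') continuous_const

/-- Over a compact parameter set and with null zero sets, the sublevel sets of mass at least `p`
each contain a member of one finite family of measurable sets of positive mass. -/
lemma exists_finite_family_subset_sublevel [OpensMeasurableSpace Ω] {μ : Measure Ω}
    [IsFiniteMeasure μ] {q : Θ → Ω → ℝ}
    (hq : ∀ θ, Continuous (q θ)) (hq' : ∀ x, Continuous fun θ => q θ x) {K : Set Θ}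
    (hK : IsCompact K) (hnull : ∀ θ ∈ K, μ {x | q θ x = 0} = 0) {p : ℝ≥0∞} (hp : p ≠ 0) :
    ∃ 𝒞 : Set (Set Ω), 𝒞.Finite ∧ (∀ C ∈ 𝒞, MeasurableSet C ∧ 0 < μ C) ∧
      ∀ θ ∈ K, p ≤ μ {x | q θ x ≤ 0} → ∃ C ∈ 𝒞, C ⊆ {x | q θ x ≤ 0} := by
  have hlt : ∀ θ ∈ K, μ {x | q θ x ≤ 0} ≤ μ {x | q θ x < 0} := by
    intro θ hθ
    calc μ {x | q θ x ≤ 0} ≤ μ ({x | q θ x < 0} ∪ {x | q θ x = 0}) :=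
          measure_mono fun x hx => lt_or_eq_of_le (show q θ x ≤ 0 from hx)
      _ ≤ μ {x | q θ x < 0} + μ {x | q θ x = 0} := measure_union_le _ _
      _ = μ {x | q θ x < 0} := by rw [hnull θ hθ, add_zero]
  refine hK.induction_on (p := fun s => ∃ 𝒞 : Set (Set Ω), 𝒞.Finite ∧
    (∀ C ∈ 𝒞, MeasurableSet C ∧ 0 < μ C) ∧
      ∀ θ ∈ s, p ≤ μ {x | q θ x ≤ 0} → ∃ C ∈ 𝒞, C ⊆ {x | q θ x ≤ 0}) ?_ ?_ ?_ ?_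
  · exact ⟨∅, Set.finite_empty, by simp, by simp⟩
  · rintro s t hst ⟨𝒞, h1, h2, h3⟩
    exact ⟨𝒞, h1, h2, fun θ hθ => h3 θ (hst hθ)⟩
  · rintro s t ⟨𝒞, h1, h2, h3⟩ ⟨𝒞', h1', h2', h3'⟩
    refine ⟨𝒞 ∪ 𝒞', h1.union h1', fun C hC => hC.elim (h2 C) (h2' C), ?_⟩
    rintro θ (hθ | hθ) h
    · obtain ⟨C, hC, hs⟩ := h3 θ hθ h
      exact ⟨C, Or.inl hC, hs⟩
    · obtain ⟨C, hC, hs⟩ := h3' θ hθ h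
      exact ⟨C, Or.inr hC, hs⟩
  · intro θ hθ
    -- If the strict sublevel set is null, nearby parameters have sublevel mass below `p` and the
    -- claim is vacuous; otherwise one closed inner approximation serves a whole neighbourhood.
    rcases eq_zero_or_pos (μ {x | q θ x < 0}) with h0 | hpos
    · have hle : μ {x | q θ x ≤ 0} = 0 := le_antisymm ((hlt θ hθ).trans h0.le) bot_le
      have hcompl : {x | -q θ x < 0} = {x | q θ x ≤ 0}ᶜ := by
        ext x
        simp
      by_cases hμ : μ Set.univ < p
      · refine ⟨K, self_mem_nhdsWithin, ∅, Set.finite_empty, by simp, fun θ' _ h => ?_⟩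
        exact absurd (h.trans (measure_mono (Set.subset_univ _))) (not_le.2 hμ)
      · have hp' : p ≤ μ Set.univ := not_lt.1 hμ
        have hpt : p ≠ ∞ := ne_top_of_le_ne_top (measure_ne_top μ _) hp'
        -- Approximating the complement from inside gives a closed `C` of mass above `μ univ - p` on
        -- which `q θ' ≥ 0` for all nearby `θ'`, leaving less than `p` for `q θ' < 0`.
        have hc : μ Set.univ - p < μ {x | -q θ x < 0} := by
          rw [hcompl, measure_compl (isClosed_le (hq θ) continuous_const).measurableSet
            (measure_ne_top _ _), hle, tsub_zero]
          exact ENNReal.sub_lt_self (measure_ne_top μ _)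
            (fun h => hp (le_antisymm (h ▸ hp') bot_le)) hp
        obtain ⟨U, hU, C, hC, hCμ, hsub⟩ := exists_nhds_subset_sublevel (q := fun θ x => -q θ x)
          (fun θ => (hq θ).neg) (fun x => (hq' x).neg) hc
        refine ⟨K ∩ U, inter_mem_nhdsWithin K hU, ∅, Set.finite_empty, by simp,
          fun θ' hθ' h => ?_⟩
        exfalso
        have hd : Disjoint C {x | q θ' x < 0} := by
          rw [Set.disjoint_left]
          intro x hx hx'
          have h1 : -q θ' x ≤ 0 := hsub θ' hθ'.2 hx
          have h2 : q θ' x < 0 := hx'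
          linarith
        have hsum : μ C + μ {x | q θ' x < 0} ≤ μ Set.univ := by
          rw [← measure_union' hd hC.measurableSet]
          exact measure_mono (Set.subset_univ _)
        have h4 : μ Set.univ < μ C + p := by
          rw [add_comm]
          exact ENNReal.sub_lt_iff_lt_left hpt hp' |>.1 hCμ
        exact absurd hsum (not_le.2 (h4.trans_le (by
          gcongr
          exact h.trans (hlt θ' hθ'.1))))
    · obtain ⟨U, hU, C, hC, hCμ, hsub⟩ := exists_nhds_subset_sublevel hq hq' hpos
      exact ⟨U, mem_nhdsWithin_of_mem_nhds hU, {C}, Set.finite_singleton C,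
        by simpa using ⟨hC.measurableSet, hCμ⟩, fun θ' hθ' _ => ⟨C, rfl, hsub θ' hθ'⟩⟩

end Family

/-- Closed balls of mass at least `p` each contain a member of one finite family of sets of
positive mass. -/
lemma exists_finite_family_subset_closedEBall {d : ℕ} (μ : Measure (E d)) [IsProbabilityMeasure μ]
    (hac : μ ≪ volume) {p : ℝ≥0∞} (hp : p ≠ 0) :
    ∃ 𝒞 : Set (Set (E d)), 𝒞.Finite ∧ (∀ C ∈ 𝒞, MeasurableSet C ∧ 0 < μ C) ∧
      ∀ x t, p ≤ μ (Metric.closedEBall x t) → ∃ C ∈ 𝒞, C ⊆ Metric.closedEBall x t := by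
  rcases Nat.eq_zero_or_pos d with rfl | hd
  -- In dimension `0` zero sets need not be null, but every closed ball is the whole space.
  · refine ⟨{Set.univ}, Set.finite_singleton _, by simp, fun x t _ => ⟨Set.univ, rfl, ?_⟩⟩
    intro y _
    rw [Subsingleton.elim y x]
    exact Metric.mem_closedEBall_self
  · have : Nonempty (Fin d) := ⟨⟨0, hd⟩⟩
    obtain ⟨𝒞, h1, h2, h3⟩ := exists_finite_family_subset_sublevel (μ := μ)
      (q := quadric (V := E d)) continuous_quadric continuous_quadric_left
      (isCompact_sphere (0 : ℝ × E d × ℝ) 1)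
      (fun θ hθ => hac (volume_quadric_eq_zero (ne_zero_of_mem_unit_sphere ⟨θ, hθ⟩))) hp
    refine ⟨𝒞, h1, h2, fun x t h => ?_⟩
    obtain ⟨θ, hθ, heq⟩ := exists_closedEBall_eq_quadric x t
    rw [heq] at h ⊢
    exact h3 θ hθ h

/-! ### Sample counts in finitely many sets -/

section Counting

variable {Z : Type*} [MeasurableSpace Z] (D : Measure Z) [IsProbabilityMeasure D]

lemma pi_forall_mem_finset {n : ℕ} (B : Finset (Fin n)) (A : Set Z) :
    Measure.pi (fun _ : Fin n => D) {S | ∀ i ∈ B, S i ∈ A} = D A ^ B.card := by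
  have h : {S : Fin n → Z | ∀ i ∈ B, S i ∈ A} =
      Set.univ.pi fun i => if i ∈ B then A else Set.univ := by
    ext S
    simp only [Set.mem_ofPred_eq, Set.mem_pi, Set.mem_univ, true_implies]
    refine forall_congr' fun i => ?_
    by_cases hi : i ∈ B <;> simp [hi]
  rw [h, Measure.pi_pi]
  have h' : ∀ i, D (if i ∈ B then A else Set.univ) = if i ∈ B then D A else 1 := by
    intro i
    split_ifs <;> simp
  simp [h']

open Classical in
/-- The probability that fewer than `k` of `n` independent samples fall in `A`. -/
lemma pi_card_lt_le (A : Set Z) (k n : ℕ) :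
    Measure.pi (fun _ : Fin n => D) {S | (Finset.univ.filter fun i => S i ∈ A).card < k} ≤
      k * D Aᶜ ^ (n / k) := by
  -- Cut out `k` disjoint blocks of `n / k` indices. With fewer than `k` hits in `A`, some block
  -- misses `A` entirely.
  let e : Fin k × Fin (n / k) ↪ Fin n :=
    finProdFinEquiv.toEmbedding.trans (Fin.castLEEmb (Nat.mul_div_le n k))
  let B : Fin k → Finset (Fin n) := fun j => Finset.univ.image fun l => e (j, l)
  have hB : ∀ j, (B j).card = n / k := by
    intro j
    rw [Finset.card_image_of_injective _ fun l l' h => (Prod.mk.inj (e.injective h)).2]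
    simp
  have hsub : {S : Fin n → Z | (Finset.univ.filter fun i => S i ∈ A).card < k} ⊆
      ⋃ j, {S | ∀ i ∈ B j, S i ∈ Aᶜ} := by
    intro S hS
    by_contra hcon
    simp only [Set.mem_iUnion, Set.mem_ofPred_eq, not_exists, not_forall, Set.mem_compl_iff,
      not_not, B, Finset.mem_image, Finset.mem_univ, true_and] at hcon
    choose g hg hgA using hcon
    choose l hl using hg
    have hinj : Function.Injective g := by
      intro j j' h
      rw [← hl j, ← hl j'] at h
      exact (Prod.mk.inj (e.injective h)).1
    have : k ≤ (Finset.univ.filter fun i => S i ∈ A).card := by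
      calc k = (Finset.univ.image g).card := by
            rw [Finset.card_image_of_injective _ hinj]
            simp
        _ ≤ _ := Finset.card_le_card fun i hi => by
            obtain ⟨j, _, rfl⟩ := Finset.mem_image.1 hi
            simpa using hgA j
    exact absurd hS (not_lt.2 this)
  calc _ ≤ Measure.pi (fun _ : Fin n => D) (⋃ j, {S | ∀ i ∈ B j, S i ∈ Aᶜ}) := measure_mono hsub
    _ ≤ ∑ j, Measure.pi (fun _ : Fin n => D) {S | ∀ i ∈ B j, S i ∈ Aᶜ} :=
        measure_iUnion_fintype_le _ _
    _ = k * D Aᶜ ^ (n / k) := by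
        rw [Finset.sum_congr rfl fun j _ => pi_forall_mem_finset D (B j) Aᶜ]
        simp [hB]

open Classical in
lemma tendsto_pi_card_lt {A : Set Z} (hA : MeasurableSet A) (hpos : 0 < D A) {k : ℕ}
    (hk : 0 < k) :
    Tendsto (fun n => Measure.pi (fun _ : Fin n => D)
      {S | (Finset.univ.filter fun i => S i ∈ A).card < k}) atTop (𝓝 0) := by
  have hlt : D Aᶜ < 1 := by
    rw [prob_compl_eq_one_sub hA]
    exact ENNReal.sub_lt_self ENNReal.one_ne_top one_ne_zero hpos.ne'
  have h1 : Tendsto (fun n : ℕ => (k : ℝ≥0∞) * D Aᶜ ^ (n / k)) atTop (𝓝 0) := by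
    have h2 := (ENNReal.tendsto_pow_atTop_nhds_zero_of_lt_one hlt).comp
      (Nat.tendsto_div_const_atTop hk.ne')
    have h3 := ENNReal.Tendsto.const_mul (a := (k : ℝ≥0∞)) h2 (Or.inr (ENNReal.natCast_ne_top k))
    rwa [mul_zero] at h3
  exact tendsto_of_tendsto_of_tendsto_of_le_of_le tendsto_const_nhds h1 (fun _ => bot_le)
    (fun n => pi_card_lt_le D A k n)

open Classical in
lemma measurableSet_card_lt {A : Set Z} (hA : MeasurableSet A) (k n : ℕ) :
    MeasurableSet {S : Fin n → Z | (Finset.univ.filter fun i => S i ∈ A).card < k} := by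
  have h : {S : Fin n → Z | (Finset.univ.filter fun i => S i ∈ A).card < k} =
      {S | ∑ i, A.indicator (fun _ => (1 : ℕ)) (S i) < k} := by
    ext S
    simp [Set.indicator_apply]
  rw [h]
  refine measurableSet_lt (Finset.measurable_sum _ fun i _ => ?_) measurable_const
  exact (measurable_const.indicator hA).comp (measurable_pi_apply i)

open Classical in
/-- For large `n`, with high probability every member of a finite family of sets of positive
mass receives at least `k` samples, and every sample satisfies a given almost sure property. -/
lemma exists_forall_withProbAtLeast {ι : Type*} {𝒞 : Set ι} (h𝒞 : 𝒞.Finite) {A : ι → Set Z}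
    (hA : ∀ C ∈ 𝒞, MeasurableSet (A C) ∧ 0 < D (A C)) {N : Set Z} (hN : MeasurableSet N)
    (hN0 : D N = 0) {k : ℕ} (hk : 0 < k) {δ : ℝ} (hδ : 0 < δ) :
    ∃ n₀ : ℕ, ∀ n : ℕ, n₀ ≤ n → WithProbAtLeast (Measure.pi fun _ : Fin n => D) (1 - δ)
      {S | (∀ i, S i ∉ N) ∧ ∀ C ∈ 𝒞, k ≤ (Finset.univ.filter fun i => S i ∈ A C).card} := by
  have hlim : Tendsto (fun n => ∑ C ∈ h𝒞.toFinset, Measure.pi (fun _ : Fin n => D)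
      {S | (Finset.univ.filter fun i => S i ∈ A C).card < k}) atTop (𝓝 0) := by
    have := tendsto_finsetSum h𝒞.toFinset fun C hC =>
      tendsto_pi_card_lt D (hA C (h𝒞.mem_toFinset.1 hC)).1 (hA C (h𝒞.mem_toFinset.1 hC)).2 hk
    simpa using this
  obtain ⟨n₀, hn₀⟩ := eventually_atTop.1
    (hlim.eventually_lt_const (ENNReal.ofReal_pos.2 hδ))
  refine ⟨n₀, fun n hn => ?_⟩
  let M : Set (Fin n → Z) := (⋃ i, {S | S i ∈ N}) ∪
    ⋃ C ∈ h𝒞.toFinset, {S | (Finset.univ.filter fun i => S i ∈ A C).card < k}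
  have hM : MeasurableSet M := by
    refine (MeasurableSet.iUnion fun i => measurable_pi_apply i hN).union ?_
    exact Finset.measurableSet_biUnion _ fun C hC =>
      measurableSet_card_lt (hA C (h𝒞.mem_toFinset.1 hC)).1 k n
  have hMle : Measure.pi (fun _ : Fin n => D) M ≤ ENNReal.ofReal δ := by
    refine (measure_union_le _ _).trans ?_
    have h0 : ∀ i, Measure.pi (fun _ : Fin n => D) {S | S i ∈ N} = 0 := fun i =>
      Measure.pi_eval_preimage_null (fun _ : Fin n => D) (i := i) hN0
    rw [measure_iUnion_null h0, zero_add]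
    exact (measure_biUnion_finset_le _ _).trans (hn₀ n hn).le
  refine ⟨Mᶜ, ?_, hM.compl, ?_⟩
  · intro S hS
    simp only [M, Set.mem_compl_iff, Set.mem_union, Set.mem_iUnion, Set.mem_ofPred_eq, not_or,
      not_exists, not_lt, Set.Finite.mem_toFinset] at hS
    exact hS
  · rw [prob_compl_eq_one_sub hM, ENNReal.ofReal_sub _ hδ.le, ENNReal.ofReal_one]
    exact tsub_le_tsub_left hMle 1

end Counting

/-! ### Labels where `η` is `0` or `1` -/

section Labels

variable {d : ℕ} {D : Measure (E d × Fin 2)} {η : E d → ℝ}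

lemma IsCondLabelProb.measure_prod_one (hη : IsCondLabelProb D η) {A : Set (E d)}
    (hA : MeasurableSet A) (h : ∀ x ∈ A, 1 ≤ η x) : D (A ×ˢ {1}) = D.fst A := by
  rw [hη.setLIntegral_eq A hA, setLIntegral_congr_fun (g := fun _ => 1) hA, setLIntegral_one]
  intro x hx
  simp [le_antisymm (hη.mem_Icc x).2 (h x hx)]

lemma IsCondLabelProb.measure_prod_one_eq_zero (hη : IsCondLabelProb D η) {A : Set (E d)}
    (hA : MeasurableSet A) (h : ∀ x ∈ A, η x ≤ 0) : D (A ×ˢ {1}) = 0 := by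
  rw [hη.setLIntegral_eq A hA, setLIntegral_congr_fun (g := fun _ => 0) hA, lintegral_zero]
  intro x hx
  simp [h x hx]

lemma measure_prod_zero_add_measure_prod_one {A : Set (E d)} (hA : MeasurableSet A) :
    D (A ×ˢ {0}) + D (A ×ˢ {1}) = D.fst A := by
  rw [Measure.fst_apply hA, ← measure_union _ (hA.prod (measurableSet_singleton _))]
  · congr 1
    ext ⟨x, y⟩
    fin_cases y <;> simp
  · rw [Set.disjoint_left]
    rintro ⟨x, y⟩ ⟨-, rfl⟩ ⟨-, h⟩
    exact absurd h (by simp)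

lemma IsCondLabelProb.measure_prod_zero (hη : IsCondLabelProb D η) {A : Set (E d)}
    (hA : MeasurableSet A) (h : ∀ x ∈ A, η x ≤ 0) : D (A ×ˢ {0}) = D.fst A := by
  rw [← measure_prod_zero_add_measure_prod_one hA, hη.measure_prod_one_eq_zero hA h, add_zero]

lemma IsCondLabelProb.measure_prod_zero_eq_zero [IsFiniteMeasure D] (hη : IsCondLabelProb D η) {A : Set (E d)}
    (hA : MeasurableSet A) (h : ∀ x ∈ A, 1 ≤ η x) : D (A ×ˢ {0}) = 0 := by
  have h1 := measure_prod_zero_add_measure_prod_one (D := D) hA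
  rw [hη.measure_prod_one hA h] at h1
  exact (ENNReal.add_left_inj (measure_ne_top D.fst A)).1 (h1.trans (zero_add _).symm)

/-- Almost surely a labelled example lies in the instance space and has the label that `η`
prescribes when `η` is `0` or `1`. -/
lemma IsCondLabelProb.exists_null [IsFiniteMeasure D] (hη : IsCondLabelProb D η) {𝒳 : Set (E d)}
    (h𝒳 : MeasurableSet 𝒳) (hD𝒳 : D.fst 𝒳ᶜ = 0) :
    ∃ N, MeasurableSet N ∧ D N = 0 ∧
      ∀ z ∉ N, z.1 ∈ 𝒳 ∧ (1 ≤ η z.1 → z.2 = 1) ∧ (η z.1 ≤ 0 → z.2 = 0) := by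
  have h1 : MeasurableSet {x | 1 ≤ η x} := measurableSet_le measurable_const hη.measurable
  have h0 : MeasurableSet {x | η x ≤ 0} := measurableSet_le hη.measurable measurable_const
  refine ⟨(Prod.fst ⁻¹' 𝒳ᶜ) ∪ ({x | 1 ≤ η x} ×ˢ {0} ∪ {x | η x ≤ 0} ×ˢ {1}), ?_, ?_, ?_⟩
  · exact (measurable_fst h𝒳.compl).union ((h1.prod (measurableSet_singleton _)).union
      (h0.prod (measurableSet_singleton _)))
  · rw [measure_union_null_iff, measure_union_null_iff, ← Measure.fst_apply h𝒳.compl]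
    exact ⟨hD𝒳, hη.measure_prod_zero_eq_zero h1 fun _ h => h,
      hη.measure_prod_one_eq_zero h0 fun _ h => h⟩
  · rintro ⟨x, y⟩ hz
    simp only [Set.mem_union, Set.mem_preimage, Set.mem_compl_iff, Set.mem_prod,
      Set.mem_ofPred_eq, Set.mem_singleton_iff, not_or, not_not, not_and] at hz
    refine ⟨hz.1, fun h => ?_, fun h => ?_⟩
    · have := hz.2.1 h
      revert this
      fin_cases y <;> simp
    · have := hz.2.2 h
      revert this
      fin_cases y <;> simp

end Labels

/-! ### From sample counts to robustness and astuteness -/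

variable {d : ℕ}

/-- The infimum defining the probability radius is attained. -/
lemma le_measure_closedEBall_probRadius (μ : Measure (E d)) [IsProbabilityMeasure μ] (p : ℝ)
    (x : E d) :
    min (ENNReal.ofReal p) 1 ≤ μ (Metric.closedEBall x (probRadius μ p x)) := by
  rcases Set.eq_empty_or_nonempty
    {t : ℝ≥0∞ | ENNReal.ofReal p ≤ μ (Metric.closedEBall x t)} with h | h
  -- No ball has mass `p`: the radius is `∞`, the ball is the whole space, and its mass `1` is why
  -- the bound is capped at `1`.
  · simp [probRadius, h]
  · obtain ⟨u, hu, hlim, hmem⟩ := exists_seq_tendsto_sInf h (OrderBot.bddBelow _)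
    have heq : Metric.closedEBall x (probRadius μ p x) = ⋂ n, Metric.closedEBall x (u n) := by
      ext y
      simp only [Set.mem_iInter, Metric.mem_closedEBall]
      exact ⟨fun hy n => hy.trans (sInf_le (hmem n)),
        fun hy => ge_of_tendsto' hlim hy⟩
    rw [heq, Antitone.measure_iInter
      (fun m n hmn => Metric.closedEBall_subset_closedEBall (hu hmn))
      (fun n => Metric.isClosed_closedEBall.measurableSet.nullMeasurableSet)
      ⟨0, measure_ne_top _ _⟩]
    exact (min_le_left _ _).trans (le_iInf hmem)

open Classical in
/-- If a ball around `x` contains `k` sample points, then it contains the `k` points nearest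
to `x`. -/
lemma mem_closedEBall_of_nearest {ι X : Type*} [Fintype ι] [PseudoMetricSpace X] {s : ι → X}
    {x : X} {t : ℝ≥0∞} {I : Finset ι} (hI : ∀ i ∈ I, ∀ j ∉ I, dist x (s i) ≤ dist x (s j))
    (hcard : I.card ≤ (Finset.univ.filter fun i => s i ∈ Metric.closedEBall x t).card)
    {i : ι} (hi : i ∈ I) : s i ∈ Metric.closedEBall x t := by
  by_contra hcon
  -- If a chosen point lies outside the ball, every sample point in the ball is strictly nearer and
  -- must be chosen too, so the ball holds fewer than `I.card` points.
  have hsub : (Finset.univ.filter fun i => s i ∈ Metric.closedEBall x t) ⊆ I.erase i := by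
    intro j hj
    have hj' : edist x (s j) ≤ t := by
      rw [edist_comm]
      simpa using hj
    have hi' : t < edist x (s i) := by
      rw [edist_comm]
      simpa using hcon
    have hlt : edist x (s j) < edist x (s i) := hj'.trans_lt hi'
    refine Finset.mem_erase.2 ⟨fun h => hlt.ne (by rw [h]), ?_⟩
    by_contra hjI
    refine absurd (hI i hi j hjI) (not_le.2 ?_)
    rw [edist_dist, edist_dist] at hlt
    exact (ENNReal.ofReal_lt_ofReal_iff_of_nonneg dist_nonneg).1 hlt
  exact absurd (hcard.trans (Finset.card_le_card hsub))
    (not_le.2 (Finset.card_erase_lt_of_mem hi))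

/-- A classifier that is constant on the instances in the open ball of radius `r` has robustness
radius at least `r`. -/
lemma le_robustnessRadius {𝒳 : Set (E d)} {f : E d → Fin 2} {x : E d} {r : ℝ}
    (h : ∀ x' ∈ 𝒳 ∩ Metric.ball x r, f x = f x') :
    ENNReal.ofReal r ≤ robustnessRadius 𝒳 f x := by
  refine le_sInf ?_
  rintro t ⟨x', ⟨hx', hd⟩, hne⟩
  by_contra hlt
  refine hne (h x' ⟨hx', ?_⟩)
  have h1 : edist x' x < ENNReal.ofReal r := (Metric.mem_closedEBall.1 hd).trans_lt (not_le.1 hlt)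
  rw [edist_dist, ENNReal.ofReal_lt_ofReal_iff_of_nonneg dist_nonneg] at h1
  exact h1

lemma IsKNNClassifier.eq_one {n k : ℕ} {S : Fin n → E d × Fin 2} {f : E d → Fin 2}
    (hf : IsKNNClassifier k S f) {x : E d} {t : ℝ≥0∞}
    (hcard : ∀ I : Finset (Fin n), I.card = k →
      (∀ i ∈ I, ∀ j ∉ I, dist x (S i).1 ≤ dist x (S j).1) → ∀ i ∈ I,
        (S i).1 ∈ Metric.closedEBall x t)
    (h : ∀ i, (S i).1 ∈ Metric.closedEBall x t → (S i).2 = 1) : f x = 1 := by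
  obtain ⟨I, hI, hnear, hfx⟩ := hf x
  rw [hfx, if_pos]
  rw [Finset.sum_congr rfl fun i hi => by rw [h i (hcard I hI hnear i hi)]]
  simp [hI]

/-- Unlike `eq_one`, this needs `0 < k`: the empty vote is a tie, and ties go to label `1`. -/
lemma IsKNNClassifier.eq_zero {n k : ℕ} (hk : 0 < k) {S : Fin n → E d × Fin 2} {f : E d → Fin 2}
    (hf : IsKNNClassifier k S f) {x : E d} {t : ℝ≥0∞}
    (hcard : ∀ I : Finset (Fin n), I.card = k →
      (∀ i ∈ I, ∀ j ∉ I, dist x (S i).1 ≤ dist x (S j).1) → ∀ i ∈ I,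
        (S i).1 ∈ Metric.closedEBall x t)
    (h : ∀ i, (S i).1 ∈ Metric.closedEBall x t → (S i).2 = 0) : f x = 0 := by
  obtain ⟨I, hI, hnear, hfx⟩ := hf x
  rw [hfx, if_neg]
  rw [Finset.sum_congr rfl fun i hi => by rw [h i (hcard I hI hnear i hi)]]
  simp [hk]

/-- If a classifier is robust and correct on the two interiors, where `η` is `1` or `0`, then its
astuteness is at least the mass of the interiors. -/
lemma measure_union_le_astuteness {D : Measure (E d × Fin 2)}
    {η : E d → ℝ} (hη : IsCondLabelProb D η) {𝒳 P N : Set (E d)} {f : E d → Fin 2} {r : ℝ}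
    (hP : ∀ x ∈ P, 1 ≤ η x ∧ f x = 1) (hN : ∀ x ∈ N, η x ≤ 0 ∧ f x = 0)
    (hr : ∀ x ∈ P ∪ N, ENNReal.ofReal r ≤ robustnessRadius 𝒳 f x) :
    D.fst (P ∪ N) ≤ astuteness 𝒳 D f r := by
  unfold astuteness
  -- Neither `f` nor the interiors are known to be measurable. The measurable hull of the event has
  -- the same mass, and its sections give measurable supersets of `P` and `N`.
  rw [← measure_toMeasurable {z : E d × Fin 2 | ENNReal.ofReal r ≤ robustnessRadius 𝒳 f z.1 ∧
    f z.1 = z.2}]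
  set M := toMeasurable D {z : E d × Fin 2 | ENNReal.ofReal r ≤ robustnessRadius 𝒳 f z.1 ∧
    f z.1 = z.2}
  have hMm : MeasurableSet M := measurableSet_toMeasurable _ _
  have hsub : ∀ x y, ENNReal.ofReal r ≤ robustnessRadius 𝒳 f x → f x = y → (x, y) ∈ M :=
    fun x y h h' => subset_toMeasurable _ _ ⟨h, h'⟩
  let A : Set (E d) := {x | (x, (1 : Fin 2)) ∈ M} ∩ {x | 1 ≤ η x}
  let B : Set (E d) := {x | (x, (0 : Fin 2)) ∈ M} ∩ {x | η x ≤ 0}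
  have hA : MeasurableSet A :=
    (measurable_prodMk_right hMm).inter (measurableSet_le measurable_const hη.measurable)
  have hB : MeasurableSet B :=
    (measurable_prodMk_right hMm).inter (measurableSet_le hη.measurable measurable_const)
  calc D.fst (P ∪ N) ≤ D.fst (A ∪ B) := by
        refine measure_mono (Set.union_subset_union (fun x hx => ?_) fun x hx => ?_)
        · exact ⟨hsub x 1 (hr x (Or.inl hx)) (hP x hx).2, (hP x hx).1⟩
        · exact ⟨hsub x 0 (hr x (Or.inr hx)) (hN x hx).2, (hN x hx).1⟩
    _ ≤ D.fst A + D.fst B := measure_union_le _ _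
    _ = D (A ×ˢ {1}) + D (B ×ˢ {0}) := by
        rw [hη.measure_prod_one hA fun x hx => hx.2, hη.measure_prod_zero hB fun x hx => hx.2]
    _ = D (A ×ˢ {1} ∪ B ×ˢ {0}) := by
        rw [measure_union _ (hB.prod (measurableSet_singleton _))]
        rw [Set.disjoint_left]
        rintro ⟨x, y⟩ ⟨-, rfl⟩ ⟨-, h⟩
        exact absurd h (by simp)
    _ ≤ D M := by
        refine measure_mono ?_
        rintro ⟨x, y⟩ (⟨hx, rfl⟩ | ⟨hx, rfl⟩)
        · exact hx.1
        · exact hx.1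

lemma WithProbAtLeast.mono {Ω : Type*} [MeasurableSpace Ω] {P : Measure Ω} {q : ℝ} {A B : Set Ω}
    (h : WithProbAtLeast P q A) (hAB : A ⊆ B) : WithProbAtLeast P q B := by
  obtain ⟨G, hG, h1, h2⟩ := h
  exact ⟨G, hG.trans hAB, h1, h2⟩

end RobustKNN

open RobustKNN in
theorem theoremA2 {d : ℕ}
    -- the instance space and the data distribution, with marginal `D.fst` concentrated on `𝒳`
    (𝒳 : Set (RobustKNN.E d)) (h𝒳 : MeasurableSet 𝒳)
    (D : Measure (RobustKNN.E d × Fin 2)) [IsProbabilityMeasure D] (hD𝒳 : D.fst 𝒳ᶜ = 0)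
    (hac : D.fst ≪ (volume : Measure (RobustKNN.E d)))
    (η : RobustKNN.E d → ℝ) (hη : RobustKNN.IsCondLabelProb D η)
    (k : ℕ) (hk : 0 < k) (p : ℝ) (hp : 0 < p) (δ : ℝ) (hδ : 0 < δ) :
    ∃ n₀ : ℕ, ∀ n : ℕ, n₀ ≤ n → ∀ r : ℝ, 0 < r →
      RobustKNN.WithProbAtLeast (Measure.pi fun _ : Fin n => D) (1 - δ)
        {S | ∀ f : RobustKNN.E d → Fin 2, RobustKNN.IsKNNClassifier k S f →
          ∀ x ∈ RobustKNN.interiorPos 𝒳 D.fst η r (1 / 2) p ∪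
              RobustKNN.interiorNeg 𝒳 D.fst η r (1 / 2) p,
            ENNReal.ofReal r ≤ RobustKNN.robustnessRadius 𝒳 f x} ∧
      RobustKNN.WithProbAtLeast (Measure.pi fun _ : Fin n => D) (1 - δ)
        {S | ∀ f : RobustKNN.E d → Fin 2, RobustKNN.IsKNNClassifier k S f →
          D.fst (RobustKNN.interiorPos 𝒳 D.fst η r (1 / 2) p ∪
              RobustKNN.interiorNeg 𝒳 D.fst η r (1 / 2) p) ≤
            RobustKNN.astuteness 𝒳 D f r} := by
  classical
  have hp0 : min (ENNReal.ofReal p) 1 ≠ 0 :=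
    (lt_min (ENNReal.ofReal_pos.2 hp) one_pos).ne'
  obtain ⟨𝒞, h𝒞, hpos, hball⟩ := exists_finite_family_subset_closedEBall D.fst hac hp0
  obtain ⟨N, hN, hN0, hgood⟩ := hη.exists_null h𝒳 hD𝒳
  obtain ⟨n₀, hn₀⟩ := exists_forall_withProbAtLeast D h𝒞
    (A := fun C => Prod.fst ⁻¹' C) (fun C hC => ⟨measurable_fst (hpos C hC).1, by
      rw [← Measure.fst_apply (hpos C hC).1]
      exact (hpos C hC).2⟩) hN hN0 hk hδ
  refine ⟨n₀, fun n hn r hr => ?_⟩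
  -- One deterministic statement on a single good event gives both conclusions, for every classifier
  -- `f` at once.
  suffices key : ∀ S ∈ {S : Fin n → E d × Fin 2 | (∀ i, S i ∉ N) ∧ ∀ C ∈ 𝒞,
        k ≤ (Finset.univ.filter fun i => S i ∈ Prod.fst ⁻¹' C).card},
      ∀ f : E d → Fin 2, IsKNNClassifier k S f →
        (∀ x ∈ interiorPos 𝒳 D.fst η r (1 / 2) p, ∀ x' ∈ 𝒳 ∩ Metric.ball x r, f x' = 1) ∧
        ∀ x ∈ interiorNeg 𝒳 D.fst η r (1 / 2) p, ∀ x' ∈ 𝒳 ∩ Metric.ball x r, f x' = 0 by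
    have hself : ∀ x ∈ 𝒳, x ∈ 𝒳 ∩ Metric.ball x r := fun x hx =>
      ⟨hx, Metric.mem_ball_self hr⟩
    have hrob : ∀ S ∈ {S : Fin n → E d × Fin 2 | (∀ i, S i ∉ N) ∧ ∀ C ∈ 𝒞,
          k ≤ (Finset.univ.filter fun i => S i ∈ Prod.fst ⁻¹' C).card},
        ∀ f : E d → Fin 2, IsKNNClassifier k S f →
          ∀ x ∈ interiorPos 𝒳 D.fst η r (1 / 2) p ∪ interiorNeg 𝒳 D.fst η r (1 / 2) p,
            ENNReal.ofReal r ≤ robustnessRadius 𝒳 f x := by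
      rintro S hS f hf x (hx | hx)
      · have h := (key S hS f hf).1 x hx
        exact le_robustnessRadius fun x' hx' => (h x (hself x hx.1.1)).trans (h x' hx').symm
      · have h := (key S hS f hf).2 x hx
        exact le_robustnessRadius fun x' hx' => (h x (hself x hx.1.1)).trans (h x' hx').symm
    refine ⟨(hn₀ n hn).mono hrob, (hn₀ n hn).mono fun S hS f hf => ?_⟩
    refine measure_union_le_astuteness hη (fun x hx => ⟨?_, ?_⟩) (fun x hx => ⟨?_, ?_⟩)
      (hrob S hS f hf)
    · have := hx.2 x (hself x hx.1.1) x ⟨hx.1.1, Metric.mem_closedEBall_self⟩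
      linarith
    · exact (key S hS f hf).1 x hx x (hself x hx.1.1)
    · have := hx.2 x (hself x hx.1.1) x ⟨hx.1.1, Metric.mem_closedEBall_self⟩
      linarith
    · exact (key S hS f hf).2 x hx x (hself x hx.1.1)
  rintro S ⟨hSN, hcount⟩ f hf
  have hnear : ∀ (x' : E d) (I : Finset (Fin n)), I.card = k →
      (∀ i ∈ I, ∀ j ∉ I, dist x' (S i).1 ≤ dist x' (S j).1) → ∀ i ∈ I,
        (S i).1 ∈ Metric.closedEBall x' (probRadius D.fst p x') := by
    intro x' I hI hI' i hi
    obtain ⟨C, hC, hCsub⟩ := hball x' _ (le_measure_closedEBall_probRadius D.fst p x')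
    refine mem_closedEBall_of_nearest (s := fun i => (S i).1) hI' ?_ hi
    rw [hI]
    exact (hcount C hC).trans (Finset.card_le_card
      (Finset.monotone_filter_right _ fun i _ h => hCsub h))
  constructor
  · intro x hx x' hx'
    refine hf.eq_one (hnear x') fun i hi => (hgood _ (hSN i)).2.1 ?_
    -- The interiors constrain `η` only on `𝒳`, so the sample point must be known to lie in `𝒳`.
    have := hx.2 x' hx' _ ⟨(hgood _ (hSN i)).1, hi⟩
    linarith
  · intro x hx x' hx'
    refine hf.eq_zero hk (hnear x') fun i hi => (hgood _ (hSN i)).2.2 ?_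
    have := hx.2 x' hx' _ ⟨(hgood _ (hSN i)).1, hi⟩
    linarith
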